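/- Let $X_1,\ldots,X_n$ be independent random vectors in $\mathbb{R}^d$ with common distribution $\mu$, and let $\mu_n := n^{-1}\sum_{i=1}^n \delta_{X_i}$ be the associated empirical measure. Let $\mathcal{A}$ be a non-empty class of Borel subsets of $\mathbb{R}^d$ that is pointwise measurable, i.e., there is an at most countable subclass $\mathcal{A}_0 \subseteq \mathcal{A}$ such that for every $A \in \mathcal{A}$ there is a sequence $(A_k)_{k}$ in $\mathcal{A}_0$ with $\mathbf{1}_{A_k}(x) \to \mathbf{1}_A(x)$ for every $x \in \mathbb{R}^d$. Let $\mathbb{A} \subseteq \mathbb{R}^d$ be a Borel set that contains every $A \in \mathcal{A}$, and put $p := \mu(\mathbb{A})$. For $m \in \mathbb{N}$ let $S_{\mathcal{A}}(m) := \max_{x_1,\ldots,x_m \in \mathbb{R}^d} \big|\big\{ \{x_1,\ldots,x_m\} \cap A : A \in \mathcal{A} \big\}\big|$ be the shattering coefficient of $\mathcal{A}$, and for real $x \ge 0$ let $S_{\mathcal{A}}(x) := S_{\mathcal{A}}(\lfloor x \rfloor)$. Let $\delta \in (0,1)$. If $np \geq 2\log(8/\delta)$, then, with probability at least $1-\delta$,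 \[ \sup_{A \in \mathcal{A}} |\mu_n(A) - \mu(A)| \;\leq\; \sqrt{\frac{2p}{n}} \left( 2 \sqrt{\log(8/\delta) + \log S_{\mathcal{A}}(8np)} + 1 \right). \] -/

import Mathlib

namespace RareVC

/-- The empirical measure `n⁻¹ ∑ᵢ δ_{xᵢ}` of the points `x₁, …, xₙ`. -/
noncomputable def empiricalMeasure {E : Type*} [MeasurableSpace E] {n : ℕ} (x : Fin n → E) :
    MeasureTheory.Measure E :=
  (n : ENNReal)⁻¹ • ∑ i, MeasureTheory.Measure.dirac (x i)

/-- The traces `{x₁, …, xₙ} ∩ A`, `A ∈ 𝒜`, of the class `𝒜` on the points `x₁, …, xₙ`. -/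
def traces {E : Type*} (𝒜 : Set (Set E)) {n : ℕ} (x : Fin n → E) : Set (Set E) :=
  {B | ∃ A ∈ 𝒜, B = Set.range x ∩ A}

/-- The shattering coefficient `S_𝒜(n)`: the largest number of traces of `𝒜` on `n` points
(repetitions among the points are allowed). -/
noncomputable def shatteringCoeff {E : Type*} (𝒜 : Set (Set E)) (n : ℕ) : ℕ :=
  ⨆ x : Fin n → E, (traces 𝒜 x).ncard

/-- The shattering coefficient at a real argument: `S_𝒜(x) = S_𝒜(⌊x⌋)`. -/
noncomputable def shatteringCoeffReal {E : Type*} (𝒜 : Set (Set E)) (x : ℝ) : ℕ :=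
  shatteringCoeff 𝒜 ⌊x⌋₊

/-- Pointwise measurability of a class of sets: there is an at most countable subclass `𝒜₀` such
that the indicator of every member of `𝒜` is a pointwise limit of a sequence of indicators of
members of `𝒜₀`. -/
def PointwiseMeasurable {E : Type*} (𝒜 : Set (Set E)) : Prop :=
  ∃ 𝒜₀ : Set (Set E), 𝒜₀ ⊆ 𝒜 ∧ 𝒜₀.Countable ∧
    ∀ A ∈ 𝒜, ∃ s : ℕ → Set E, (∀ k, s k ∈ 𝒜₀) ∧
      ∀ x : E, Filter.Tendsto (fun k => (s k).indicator (fun _ => (1 : ℝ)) x) Filter.atTop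
        (nhds (A.indicator (fun _ => (1 : ℝ)) x))

/-- The maximal deviation `sup_{A ∈ 𝒜} |ν(A) - μ(A)|`. -/
noncomputable def maxDeviation {E : Type*} [MeasurableSpace E] (𝒜 : Set (Set E))
    (ν μ : MeasureTheory.Measure E) : ℝ :=
  ⨆ A : 𝒜, |ν.real (A : Set E) - μ.real (A : Set E)|

/-- At most `2 ^ n` traces on `n` points. -/
theorem ncard_traces_le {E : Type*} (𝒜 : Set (Set E)) {n : ℕ} (x : Fin n → E) :
    (traces 𝒜 x).ncard ≤ 2 ^ n := by
  classical
  have hsub : traces 𝒜 x ⊆ 𝒫 (Set.range x) := by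
    rintro B ⟨A, -, rfl⟩
    exact Set.inter_subset_left
  have hfin : (Set.range x).Finite := Set.finite_range x
  refine (Set.ncard_le_ncard hsub hfin.powerset).trans ?_
  rw [Set.ncard_powerset (Set.range x) hfin]
  refine Nat.pow_le_pow_right (by norm_num) ?_
  rw [← Set.image_univ]
  refine (Set.ncard_image_le Set.finite_univ).trans ?_
  simp [Set.ncard_univ]

/-- The maximum defining the shattering coefficient is over a bounded family, so the supremum in
`ℕ` is a genuine one. -/
theorem bddAbove_ncard_traces {E : Type*} (𝒜 : Set (Set E)) (n : ℕ) :
    BddAbove (Set.range fun x : Fin n → E => (traces 𝒜 x).ncard) := by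
  refine ⟨2 ^ n, ?_⟩
  rintro _ ⟨x, rfl⟩
  exact ncard_traces_le 𝒜 x

/-- For finite measures the supremum defining the maximal deviation is over a bounded family, so
it is a genuine one. -/
theorem bddAbove_deviation {E : Type*} [MeasurableSpace E] (𝒜 : Set (Set E))
    (ν μ : MeasureTheory.Measure E) [MeasureTheory.IsFiniteMeasure ν]
    [MeasureTheory.IsFiniteMeasure μ] :
    BddAbove (Set.range fun A : 𝒜 => |ν.real (A : Set E) - μ.real (A : Set E)|) := by
  refine ⟨ν.real Set.univ + μ.real Set.univ, ?_⟩
  rintro _ ⟨A, rfl⟩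
  have h1 : ν.real (A : Set E) ≤ ν.real Set.univ :=
    MeasureTheory.measureReal_mono (Set.subset_univ _)
  have h2 : μ.real (A : Set E) ≤ μ.real Set.univ :=
    MeasureTheory.measureReal_mono (Set.subset_univ _)
  have h3 : 0 ≤ ν.real (A : Set E) := MeasureTheory.measureReal_nonneg
  have h4 : 0 ≤ μ.real (A : Set E) := MeasureTheory.measureReal_nonneg
  exact abs_le.2 ⟨by linarith, by linarith⟩

/-- The empirical measure of at least one point is a probability measure. -/
theorem isProbabilityMeasure_empiricalMeasure {E : Type*} [MeasurableSpace E] {n : ℕ}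
    (hn : n ≠ 0) (x : Fin n → E) :
    MeasureTheory.IsProbabilityMeasure (empiricalMeasure x) := by
  constructor
  simp only [empiricalMeasure, MeasureTheory.Measure.smul_apply,
    MeasureTheory.Measure.finsetSum_apply, MeasureTheory.measure_univ, Finset.sum_const,
    Finset.card_univ, Fintype.card_fin, nsmul_eq_mul, mul_one, smul_eq_mul]
  exact ENNReal.inv_mul_cancel (by exact_mod_cast hn) (ENNReal.natCast_ne_top n)

end RareVC

namespace RareVC

open MeasureTheory ProbabilityTheory Filter Topology

/-! ### Shattering coefficients -/

/-! The proof is Vapnik–Chervonenkis symmetrization, localized to `R`, where all sets of the class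
live. Counts are used in place of frequencies, and the threshold is split as `n * t = s + u`. By
Chebyshev, an independent ghost sample has count within `s = √(2np)` of its mean with probability at
least 1/2, so a deviation beyond `s + u` costs at most twice the probability that the two samples
differ by more than `u` on some set (`measure_le_two_mul_prod`).

Swapping the members of each pair preserves the law, so it suffices to count bad sign patterns for
fixed pairs (`measure_le_of_card_le`). Only points in `R` matter: their number bounds both the
variance proxy in Hoeffding's inequality and the number of points on which traces are taken
(`card_exists_lt_abs_sum_sign_le`). It has mean `2np` and exceeds `4np` with probability at most
`exp (-np/2)`. This gives `2 * (S(4np) * 2 * exp (-u²/(8np)) + exp (-np/2))`, and `u` is chosen so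
that the total is at most `3δ/4`. Pointwise measurability reduces everything to a countable
subclass. -/

theorem finite_traces {E : Type*} (𝒜 : Set (Set E)) {n : ℕ} (x : Fin n → E) :
    (traces 𝒜 x).Finite := by
  refine (Set.finite_range x).powerset.subset ?_
  rintro B ⟨A, -, rfl⟩
  exact Set.inter_subset_left

theorem ncard_traces_le_shatteringCoeff {E : Type*} (𝒜 : Set (Set E)) {n : ℕ} (x : Fin n → E) :
    (traces 𝒜 x).ncard ≤ shatteringCoeff 𝒜 n :=
  le_ciSup (bddAbove_ncard_traces 𝒜 n) x

theorem one_le_shatteringCoeff {E : Type*} [Nonempty E] {𝒜 : Set (Set E)} (h : 𝒜.Nonempty)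
    (n : ℕ) : 1 ≤ shatteringCoeff 𝒜 n := by
  obtain ⟨A, hA⟩ := h
  refine le_trans ?_ (ncard_traces_le_shatteringCoeff 𝒜 fun _ : Fin n => Classical.arbitrary E)
  exact (Set.ncard_pos (finite_traces _ _)).2 ⟨_, A, hA, rfl⟩

/-- Padding a list by repeating its first point keeps its range, hence its traces. The empty list
has no point to repeat, but its only possible trace is empty. -/
theorem shatteringCoeff_mono {E : Type*} [Nonempty E] (𝒜 : Set (Set E)) :
    Monotone (shatteringCoeff 𝒜) := by
  intro m n hmn
  refine ciSup_le fun x => ?_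
  rcases Nat.eq_zero_or_pos m with rfl | hm
  · have hsub : traces 𝒜 x ⊆ (fun B => B ∩ Set.range x) ''
        traces 𝒜 (fun _ : Fin n => Classical.arbitrary E) := by
      rintro B ⟨A, hA, rfl⟩
      exact ⟨_, ⟨A, hA, rfl⟩, by simp⟩
    exact ((Set.ncard_le_ncard hsub ((finite_traces _ _).image _)).trans
      (Set.ncard_image_le (finite_traces _ _))).trans (ncard_traces_le_shatteringCoeff _ _)
  · let y : Fin n → E := fun i => if h : (i : ℕ) < m then x ⟨i, h⟩ else x ⟨0, hm⟩
    have hy : Set.range y = Set.range x := by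
      ext e
      constructor
      · rintro ⟨i, rfl⟩
        by_cases h : (i : ℕ) < m
        · exact ⟨⟨i, h⟩, by simp [y, h]⟩
        · exact ⟨⟨0, hm⟩, by simp [y, h]⟩
      · rintro ⟨i, rfl⟩
        exact ⟨⟨i, i.2.trans_le hmn⟩, by simp [y]⟩
    have : traces 𝒜 x = traces 𝒜 y := by simp [traces, hy]
    rw [this]
    exact ncard_traces_le_shatteringCoeff 𝒜 y

/-! ### Random signs -/

/-- The sign attached to a Boolean. -/
def sign (b : Bool) : ℝ := cond b (-1) 1

/-- The sum over signs factorizes into hyperbolic cosines, and `cosh x ≤ exp (x² / 2)`. -/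
theorem sum_exp_sign_le {n : ℕ} (a : Fin n → ℝ) {V : ℝ} (hV : ∑ i, a i ^ 2 ≤ V) (l : ℝ) :
    ∑ ε : Fin n → Bool, Real.exp (l * ∑ i, sign (ε i) * a i) ≤
      2 ^ n * Real.exp (l ^ 2 * V / 2) := by
  have h1 : ∑ ε : Fin n → Bool, Real.exp (l * ∑ i, sign (ε i) * a i) =
      ∏ i, (2 * Real.cosh (l * a i)) := by
    have := Finset.prod_univ_sum (fun _ : Fin n => (Finset.univ : Finset Bool))
      (fun i b => Real.exp (l * (sign b * a i)))
    rw [Fintype.piFinset_univ] at this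
    calc _ = ∑ ε : Fin n → Bool, ∏ i, Real.exp (l * (sign (ε i) * a i)) := by
          simp only [Finset.mul_sum, Real.exp_sum]
      _ = _ := this.symm
      _ = _ := by
          refine Finset.prod_congr rfl fun i _ => ?_
          rw [Fintype.sum_bool, Real.cosh_eq]
          simp only [sign, cond_true, cond_false]
          ring_nf
  rw [h1, Finset.prod_mul_distrib]
  simp only [Finset.prod_const, Finset.card_univ, Fintype.card_fin]
  gcongr
  calc ∏ i, Real.cosh (l * a i) ≤ ∏ i, Real.exp ((l * a i) ^ 2 / 2) :=
        Finset.prod_le_prod (fun i _ => (Real.cosh_pos _).le)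
          fun i _ => Real.cosh_le_exp_half_sq _
    _ = Real.exp (l ^ 2 * (∑ i, a i ^ 2) / 2) := by
        rw [← Real.exp_sum, Finset.mul_sum, Finset.sum_div]
        simp only [mul_pow]
    _ ≤ _ := by gcongr

theorem card_lt_sum_sign_le {n : ℕ} (a : Fin n → ℝ) {V u : ℝ} (hV0 : 0 < V) (hu : 0 ≤ u)
    (hV : ∑ i, a i ^ 2 ≤ V) :
    ((Finset.univ.filter fun ε : Fin n → Bool => u < ∑ i, sign (ε i) * a i).card : ℝ) ≤
      2 ^ n * Real.exp (-(u ^ 2 / (2 * V))) := by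
  have hl : 0 ≤ u / V := by positivity
  -- `l = u / V` minimizes the Chernoff exponent `l² V / 2 - l u`.
  have h := sum_exp_sign_le a hV (u / V)
  have h2 : ((Finset.univ.filter fun ε : Fin n → Bool => u < ∑ i, sign (ε i) * a i).card : ℝ) *
      Real.exp (u / V * u) ≤ ∑ ε : Fin n → Bool, Real.exp (u / V * ∑ i, sign (ε i) * a i) := by
    rw [← nsmul_eq_mul, ← Finset.sum_const]
    refine (Finset.sum_le_sum fun ε hε => ?_).trans
      (Finset.sum_le_sum_of_subset_of_nonneg (Finset.filter_subset _ _)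
        fun _ _ _ => (Real.exp_pos _).le)
    have := (Finset.mem_filter.1 hε).2
    gcongr
  have h3 := h2.trans h
  rw [← le_div_iff₀ (Real.exp_pos _), mul_div_assoc, ← Real.exp_sub] at h3
  have h4 : (u / V) ^ 2 * V / 2 - u / V * u = -(u ^ 2 / (2 * V)) := by
    field_simp
    ring
  rwa [h4] at h3

theorem card_lt_abs_sum_sign_le {n : ℕ} (a : Fin n → ℝ) {V u : ℝ} (hV0 : 0 < V) (hu : 0 ≤ u)
    (hV : ∑ i, a i ^ 2 ≤ V) :
    ((Finset.univ.filter fun ε : Fin n → Bool => u < |∑ i, sign (ε i) * a i|).card : ℝ) ≤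
      2 ^ n * (2 * Real.exp (-(u ^ 2 / (2 * V)))) := by
  have h1 := card_lt_sum_sign_le a hV0 hu hV
  have h2 := card_lt_sum_sign_le (fun i => -a i) hV0 hu (by simpa using hV)
  have h3 : (Finset.univ.filter fun ε : Fin n → Bool => u < |∑ i, sign (ε i) * a i|) ⊆
      (Finset.univ.filter fun ε : Fin n → Bool => u < ∑ i, sign (ε i) * a i) ∪
      (Finset.univ.filter fun ε : Fin n → Bool => u < ∑ i, sign (ε i) * -a i) := by
    intro ε hε
    simp only [Finset.mem_union, Finset.mem_filter, Finset.mem_univ, true_and, mul_neg,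
      Finset.sum_neg_distrib] at hε ⊢
    exact lt_abs.1 hε
  have h4 := (Finset.card_le_card h3).trans (Finset.card_union_le _ _)
  rw [← Nat.cast_le (α := ℝ), Nat.cast_add] at h4
  linarith

/-! ### Pairs of sample points -/

/-- The difference of the indicators of `A` at the two points of a pair. -/
noncomputable def pairDiff {E : Type*} (A : Set E) (z : E × E) : ℝ :=
  A.indicator 1 z.1 - A.indicator 1 z.2

/-- The number of points of a pair that lie in `R`. -/
noncomputable def pairCount {E : Type*} (R : Set E) (z : E × E) : ℝ :=
  R.indicator 1 z.1 + R.indicator 1 z.2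

theorem pairDiff_sq_le {E : Type*} {A R : Set E} (h : A ⊆ R) (z : E × E) :
    pairDiff A z ^ 2 ≤ pairCount R z := by
  classical
  have h1 := @h z.1
  have h2 := @h z.2
  simp only [pairDiff, pairCount, Set.indicator_apply, Pi.one_apply]
  split_ifs <;> norm_num <;> tauto

theorem pairDiff_congr {E : Type*} {A B : Set E} {z : E × E} (h1 : z.1 ∈ A ↔ z.1 ∈ B)
    (h2 : z.2 ∈ A ↔ z.2 ∈ B) : pairDiff A z = pairDiff B z := by
  classical
  simp only [pairDiff, Set.indicator_apply, h1, h2]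

/-- The points of a finite family of pairs that lie in `R` can be listed. -/
theorem exists_enumeration {E : Type*} {n : ℕ} (R : Set E) (z : Fin n → E × E) :
    ∃ (m : ℕ) (y : Fin m → E), (m : ℝ) = ∑ i, pairCount R (z i) ∧
      ∀ i, ((z i).1 ∈ R → (z i).1 ∈ Set.range y) ∧ ((z i).2 ∈ R → (z i).2 ∈ Set.range y) := by
  classical
  let w : Fin n ⊕ Fin n → E := Sum.elim (fun i => (z i).1) (fun i => (z i).2)
  let S := {j : Fin n ⊕ Fin n // w j ∈ R}
  let e : S ≃ Fin (Fintype.card S) := Fintype.equivFin S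
  refine ⟨Fintype.card S, fun k => w (e.symm k).1, ?_, fun i => ⟨fun h => ?_, fun h => ?_⟩⟩
  · rw [Fintype.card_subtype, ← Finset.sum_boole, Fintype.sum_sum_type, ← Finset.sum_add_distrib]
    refine Finset.sum_congr rfl fun i _ => ?_
    by_cases h1 : (z i).1 ∈ R <;> by_cases h2 : (z i).2 ∈ R <;> simp [w, pairCount, h1, h2]
  · exact ⟨e ⟨Sum.inl i, h⟩, by simp [w]⟩
  · exact ⟨e ⟨Sum.inr i, h⟩, by simp [w]⟩

/-- Union bound over traces: since `A ⊆ R`, the differences for `A` depend only on its trace on the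
at most `V` listed points in `R`. -/
theorem card_exists_lt_abs_sum_sign_le {E : Type*} [Nonempty E] {n : ℕ} {𝒜 : Set (Set E)}
    {R : Set E} (h𝒜R : ∀ A ∈ 𝒜, A ⊆ R) {V u : ℝ} (hV0 : 0 < V) (hu : 0 ≤ u)
    (z : Fin n → E × E) (hz : ∑ i, pairCount R (z i) ≤ V) :
    (Nat.card {ε : Fin n → Bool // ∃ A ∈ 𝒜, u < |∑ i, sign (ε i) * pairDiff A (z i)|} : ℝ) ≤
      2 ^ n * (shatteringCoeffReal 𝒜 V * (2 * Real.exp (-(u ^ 2 / (2 * V))))) := by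
  classical
  obtain ⟨m, y, hm, hy⟩ := exists_enumeration R z
  have hdiff : ∀ A ∈ 𝒜, ∀ i, pairDiff (Set.range y ∩ A) (z i) = pairDiff A (z i) := by
    intro A hA i
    refine pairDiff_congr ?_ ?_
    · exact ⟨fun h => h.2, fun h => ⟨(hy i).1 (h𝒜R A hA h), h⟩⟩
    · exact ⟨fun h => h.2, fun h => ⟨(hy i).2 (h𝒜R A hA h), h⟩⟩
  rw [Nat.card_eq_fintype_card, Fintype.card_subtype]
  have hfin := finite_traces 𝒜 y
  have hsub : (Finset.univ.filter fun ε : Fin n → Bool =>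
        ∃ A ∈ 𝒜, u < |∑ i, sign (ε i) * pairDiff A (z i)|) ⊆
      hfin.toFinset.biUnion fun T => Finset.univ.filter fun ε : Fin n → Bool =>
        u < |∑ i, sign (ε i) * pairDiff T (z i)| := by
    intro ε hε
    obtain ⟨A, hA, hlt⟩ := (Finset.mem_filter.1 hε).2
    refine Finset.mem_biUnion.2 ⟨Set.range y ∩ A, hfin.mem_toFinset.2 ⟨A, hA, rfl⟩, ?_⟩
    simpa [hdiff A hA] using hlt
  have hcard : hfin.toFinset.card ≤ shatteringCoeffReal 𝒜 V := by
    rw [← Set.ncard_eq_toFinset_card _ hfin]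
    refine (ncard_traces_le_shatteringCoeff 𝒜 y).trans (shatteringCoeff_mono 𝒜 (Nat.le_floor ?_))
    exact hm.trans_le hz
  have hT : ∀ T ∈ hfin.toFinset, ((Finset.univ.filter fun ε : Fin n → Bool =>
      u < |∑ i, sign (ε i) * pairDiff T (z i)|).card : ℝ) ≤
      2 ^ n * (2 * Real.exp (-(u ^ 2 / (2 * V)))) := by
    intro T hT
    obtain ⟨A, hA, rfl⟩ := hfin.mem_toFinset.1 hT
    refine card_lt_abs_sum_sign_le _ hV0 hu (le_trans (Finset.sum_le_sum fun i _ => ?_) hz)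
    exact pairDiff_sq_le (Set.inter_subset_right.trans (h𝒜R A hA)) (z i)
  calc _ ≤ ((∑ T ∈ hfin.toFinset, (Finset.univ.filter fun ε : Fin n → Bool =>
        u < |∑ i, sign (ε i) * pairDiff T (z i)|).card : ℕ) : ℝ) :=
        mod_cast (Finset.card_le_card hsub).trans Finset.card_biUnion_le
    _ ≤ ∑ T ∈ hfin.toFinset, 2 ^ n * (2 * Real.exp (-(u ^ 2 / (2 * V)))) := by
        push_cast
        exact Finset.sum_le_sum hT
    _ = hfin.toFinset.card * (2 ^ n * (2 * Real.exp (-(u ^ 2 / (2 * V))))) := by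
        rw [Finset.sum_const, nsmul_eq_mul]
    _ ≤ shatteringCoeffReal 𝒜 V * (2 ^ n * (2 * Real.exp (-(u ^ 2 / (2 * V))))) := by
        gcongr
    _ = _ := by ring

/-! ### Symmetrization -/

/-- By invariance, `W C` is the integral of the fraction of the `φ ε` that send `z` into `C`; this
fraction is at most `q` off `G` and at most 1 on `G`. -/
theorem measure_le_of_card_le {Z ι : Type*} [MeasurableSpace Z] [Fintype ι] [Nonempty ι]
    (W : Measure Z) [IsProbabilityMeasure W] (φ : ι → Z → Z)
    (hφ : ∀ ε, MeasurePreserving (φ ε) W W) {C G : Set Z} (hC : MeasurableSet C)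
    (hG : MeasurableSet G) {q : ℝ}
    (hcard : ∀ z ∉ G, (Nat.card {ε // φ ε z ∈ C} : ℝ) ≤ Fintype.card ι * q) :
    W C ≤ ENNReal.ofReal q + W G := by
  classical
  have hpt : ∀ z, ∑ ε, (φ ε ⁻¹' C).indicator (1 : Z → ENNReal) z ≤
      Fintype.card ι * (ENNReal.ofReal q + G.indicator 1 z) := by
    intro z
    have hsum : ∑ ε, (φ ε ⁻¹' C).indicator (1 : Z → ENNReal) z =
        (Nat.card {ε // φ ε z ∈ C} : ENNReal) := by
      rw [Nat.card_eq_fintype_card, Fintype.card_subtype, ← Finset.sum_boole]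
      refine Finset.sum_congr rfl fun ε _ => ?_
      by_cases h : φ ε z ∈ C <;> simp [h]
    rw [hsum]
    by_cases hz : z ∈ G
    · have h1 : Nat.card {ε // φ ε z ∈ C} ≤ Fintype.card ι := by
        rw [Nat.card_eq_fintype_card]
        exact Fintype.card_subtype_le _
      simp only [Set.indicator_of_mem hz, Pi.one_apply]
      calc (Nat.card {ε // φ ε z ∈ C} : ENNReal) ≤ Fintype.card ι * 1 := by
            rw [mul_one]; exact_mod_cast h1
        _ ≤ _ := by gcongr; exact le_add_self
    · rw [Set.indicator_of_notMem hz, add_zero, ← ENNReal.ofReal_natCast,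
        ← ENNReal.ofReal_natCast, ← ENNReal.ofReal_mul (Nat.cast_nonneg _)]
      exact ENNReal.ofReal_le_ofReal (hcard z hz)
  have hint : ∫⁻ z, ∑ ε, (φ ε ⁻¹' C).indicator (1 : Z → ENNReal) z ∂W =
      Fintype.card ι * W C := by
    rw [lintegral_finsetSum]
    · simp [lintegral_indicator_one ((hφ _).measurable hC), (hφ _).measure_preimage
        hC.nullMeasurableSet]
    · exact fun ε _ => measurable_one.indicator ((hφ ε).measurable hC)
  have hGm : Measurable (G.indicator (1 : Z → ENNReal)) := measurable_one.indicator hG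
  have h := lintegral_mono (μ := W) hpt
  rw [hint, lintegral_const_mul _ (by fun_prop), lintegral_add_left measurable_const,
    lintegral_indicator_one hG] at h
  simp only [lintegral_const, measure_univ, mul_one] at h
  refine (ENNReal.mul_le_mul_iff_right ?_ (ENNReal.natCast_ne_top _)).1 h
  exact_mod_cast Fintype.card_ne_zero

theorem measure_le_two_mul_prod {Y Y' : Type*} [MeasurableSpace Y] [MeasurableSpace Y']
    (Q : Measure Y) (Q' : Measure Y') [SFinite Q'] {B : Set Y} {C : Set (Y × Y')}
    (hB : MeasurableSet B) (hC : MeasurableSet C)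
    (h : ∀ x ∈ B, 1 / 2 ≤ Q' (Prod.mk x ⁻¹' C)) : Q B ≤ 2 * Q.prod Q' C := by
  have h1 : (1 / 2) * Q B ≤ Q.prod Q' C := by
    rw [Measure.prod_apply hC, ← lintegral_indicator_const hB]
    refine lintegral_mono fun x => ?_
    by_cases hx : x ∈ B
    · simpa [hx] using h x hx
    · simp [hx]
  calc Q B = 2 * ((1 / 2) * Q B) := by
        rw [← mul_assoc, one_div, ENNReal.mul_inv_cancel (by simp) (by simp), one_mul]
    _ ≤ _ := by gcongr

/-- Swap the two components of a pair if the Boolean is `true`. -/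
def swapIf {E : Type*} (b : Bool) (z : E × E) : E × E := cond b z.swap z

theorem measurePreserving_swapIf {E : Type*} [MeasurableSpace E] (μ : Measure E) [SFinite μ]
    (b : Bool) : MeasurePreserving (swapIf b) (μ.prod μ) (μ.prod μ) := by
  cases b
  · exact MeasurePreserving.id _
  · exact Measure.measurePreserving_swap

theorem pairDiff_swapIf {E : Type*} (A : Set E) (b : Bool) (z : E × E) :
    pairDiff A (swapIf b z) = sign b * pairDiff A z := by
  cases b <;> simp [swapIf, sign, pairDiff]

theorem measurable_indicator_one {E : Type*} [MeasurableSpace E] {A : Set E}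
    (hA : MeasurableSet A) : Measurable (A.indicator (1 : E → ℝ)) :=
  measurable_one.indicator hA

theorem measurable_pairDiff {E : Type*} [MeasurableSpace E] {A : Set E} (hA : MeasurableSet A) :
    Measurable (pairDiff A) :=
  ((measurable_indicator_one hA).comp measurable_fst).sub
    ((measurable_indicator_one hA).comp measurable_snd)

theorem measurable_pairCount {E : Type*} [MeasurableSpace E] {R : Set E} (hR : MeasurableSet R) :
    Measurable (pairCount R) :=
  ((measurable_indicator_one hR).comp measurable_fst).add
    ((measurable_indicator_one hR).comp measurable_snd)

/-! ### Tail bounds for counts -/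

/-- An indicator `b` satisfies `2 ^ b = 1 + b`, and the `2 * n` points are independent. -/
theorem integral_pi_prod_two_rpow_pairCount {E : Type*} [MeasurableSpace E] (μ : Measure E)
    [IsProbabilityMeasure μ] {R : Set E} (hR : MeasurableSet R) (n : ℕ) :
    ∫ z : Fin n → E × E, ∏ i, (2 : ℝ) ^ pairCount R (z i) ∂Measure.pi (fun _ => μ.prod μ) =
      (1 + μ.real R) ^ (2 * n) := by
  have hpow : ∀ x, (2 : ℝ) ^ (R.indicator (1 : E → ℝ) x) = 1 + R.indicator (1 : E → ℝ) x := by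
    intro x
    by_cases hx : x ∈ R <;> simp [hx]
    norm_num
  have h1 : ∫ x, (2 : ℝ) ^ (R.indicator (1 : E → ℝ) x) ∂μ = 1 + μ.real R := by
    simp_rw [hpow]
    have hint : Integrable (R.indicator (1 : E → ℝ)) μ :=
      (integrable_const (1 : ℝ)).indicator hR
    rw [integral_add (integrable_const _) hint, integral_indicator_one hR]
    simp
  rw [integral_fintype_prod_eq_pow (fun z : E × E => (2 : ℝ) ^ pairCount R z)]
  simp_rw [pairCount, Real.rpow_add two_pos]
  rw [integral_prod_mul (fun x => (2 : ℝ) ^ (R.indicator (1 : E → ℝ) x))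
    (fun x => (2 : ℝ) ^ (R.indicator (1 : E → ℝ) x)), h1, Fintype.card_fin, pow_mul, sq]

theorem measureReal_lt_sum_pairCount_le {E : Type*} [MeasurableSpace E] (μ : Measure E)
    [IsProbabilityMeasure μ] {R : Set E} (hR : MeasurableSet R) (n : ℕ) :
    (Measure.pi fun _ : Fin n => μ.prod μ).real
      {z | 4 * n * μ.real R < ∑ i, pairCount R (z i)} ≤ Real.exp (-(n * μ.real R / 2)) := by
  set p := μ.real R
  have hp : 0 ≤ p := measureReal_nonneg
  have hmeas := measurable_pairCount hR
  have hint : Integrable (fun z : Fin n → E × E => ∏ i, (2 : ℝ) ^ pairCount R (z i))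
      (Measure.pi fun _ => μ.prod μ) := by
    refine Integrable.fintype_prod (f := fun _ z => (2 : ℝ) ^ pairCount R z) fun _ => ?_
    refine Integrable.of_bound (hmeas.const_pow 2).aestronglyMeasurable 4
      (Eventually.of_forall fun z => ?_)
    by_cases h1 : z.1 ∈ R <;> by_cases h2 : z.2 ∈ R <;> norm_num [pairCount, h1, h2]
  have hM := mul_meas_ge_le_integral_of_nonneg
    (Eventually.of_forall fun z : Fin n → E × E =>
      Finset.prod_nonneg fun i _ => (Real.rpow_pos_of_pos two_pos (pairCount R (z i))).le)
    hint ((2 : ℝ) ^ (4 * n * p))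
  rw [integral_pi_prod_two_rpow_pairCount μ hR] at hM
  have hsub : {z : Fin n → E × E | 4 * n * p < ∑ i, pairCount R (z i)} ⊆
      {z | (2 : ℝ) ^ (4 * n * p) ≤ ∏ i, (2 : ℝ) ^ pairCount R (z i)} := by
    intro z hz
    rw [Set.mem_ofPred_eq, ← Real.rpow_sum_of_pos two_pos]
    exact Real.rpow_le_rpow_of_exponent_le one_le_two hz.le
  have hle : (1 + p) ^ (2 * n) ≤ Real.exp (2 * n * p) := by
    calc (1 + p) ^ (2 * n) ≤ Real.exp p ^ (2 * n) := by
          gcongr; linarith [Real.add_one_le_exp p]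
      _ = _ := by rw [← Real.exp_nat_mul]; push_cast; rfl
  have h2 : (2 : ℝ) ^ (4 * n * p) * (Measure.pi fun _ : Fin n => μ.prod μ).real
      {z | 4 * n * p < ∑ i, pairCount R (z i)} ≤ Real.exp (2 * n * p) :=
    (mul_le_mul_of_nonneg_left (measureReal_mono hsub) (by positivity)).trans (hM.trans hle)
  rw [mul_comm, ← le_div_iff₀ (by positivity), Real.rpow_def_of_pos two_pos,
    ← Real.exp_sub] at h2
  refine h2.trans (Real.exp_le_exp.2 ?_)
  have : 0 ≤ (n : ℝ) * p := by positivity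
  -- The exponent is `(2 - 4 log 2) np`, and `4 log 2 - 2 > 1/2`.
  nlinarith [Real.log_two_gt_d9]

/-- Chebyshev: the count has variance at most `n μ(A) ≤ s² / 2`. -/
theorem half_le_measure_abs_sum_indicator_sub_lt {E : Type*} [MeasurableSpace E] (μ : Measure E)
    [IsProbabilityMeasure μ] {A : Set E} (hA : MeasurableSet A) {n : ℕ} {s : ℝ} (hs : 0 < s)
    (hsA : 2 * n * μ.real A ≤ s ^ 2) :
    1 / 2 ≤ (Measure.pi fun _ : Fin n => μ)
      {x | |∑ i, A.indicator (1 : E → ℝ) (x i) - n * μ.real A| < s} := by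
  have hmeas := measurable_indicator_one hA
  have hL : MemLp (A.indicator (1 : E → ℝ)) 2 μ := by
    refine MemLp.of_bound hmeas.aestronglyMeasurable 1 (Eventually.of_forall fun x => ?_)
    by_cases hx : x ∈ A <;> simp [hx]
  have hmp : ∀ i, MeasurePreserving (fun x : Fin n → E => x i) (Measure.pi fun _ => μ) μ :=
    fun i => measurePreserving_eval (fun _ : Fin n => μ) i
  have hLi : ∀ i, MemLp (fun x : Fin n → E => A.indicator (1 : E → ℝ) (x i)) 2
      (Measure.pi fun _ => μ) := fun i => hL.comp_measurePreserving (hmp i)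
  have hvar1 : Var[A.indicator (1 : E → ℝ); μ] ≤ μ.real A := by
    refine (variance_le_expectation_sq hmeas.aestronglyMeasurable).trans_eq ?_
    rw [← integral_indicator_one hA]
    refine integral_congr_ae (Eventually.of_forall fun x => ?_)
    by_cases hx : x ∈ A <;> simp [hx]
  have hvar : Var[∑ i, fun x : Fin n → E => A.indicator (1 : E → ℝ) (x i);
      Measure.pi fun _ => μ] ≤ n * μ.real A := by
    rw [variance_sum_pi (fun _ => hL)]
    simpa using mul_le_mul_of_nonneg_left hvar1 (Nat.cast_nonneg n)
  have hmean : ∫ x : Fin n → E, (∑ i, fun x : Fin n → E => A.indicator (1 : E → ℝ) (x i)) x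
      ∂(Measure.pi fun _ => μ) = n * μ.real A := by
    simp only [Finset.sum_apply]
    rw [integral_finsetSum _ fun i _ => (hLi i).integrable one_le_two]
    have : ∀ i, ∫ x : Fin n → E, A.indicator (1 : E → ℝ) (x i) ∂(Measure.pi fun _ => μ) =
        μ.real A := by
      intro i
      rw [← integral_indicator_one hA, ← (hmp i).map_eq, integral_map
        (hmp i).measurable.aemeasurable hmeas.aestronglyMeasurable]
      rw [(hmp i).map_eq]
    simp [this]
  have hcheb := meas_ge_le_variance_div_sq (memLp_finsetSum' Finset.univ fun i _ => hLi i) hs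
  rw [hmean] at hcheb
  have hhalf : ENNReal.ofReal (Var[∑ i, fun x : Fin n → E => A.indicator (1 : E → ℝ) (x i);
      Measure.pi fun _ => μ] / s ^ 2) ≤ 1 / 2 := by
    rw [ENNReal.ofReal_le_iff_le_toReal (by simp)]
    rw [div_le_iff₀ (by positivity)]
    norm_num
    linarith
  have hset : {x : Fin n → E | |∑ i, A.indicator (1 : E → ℝ) (x i) - n * μ.real A| < s} =
      {x | s ≤ |(∑ i, fun x : Fin n → E => A.indicator (1 : E → ℝ) (x i)) x -
        n * μ.real A|}ᶜ := by
    ext x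
    simp
  have hms : MeasurableSet {x : Fin n → E |
      s ≤ |(∑ i, fun x : Fin n → E => A.indicator (1 : E → ℝ) (x i)) x - n * μ.real A|} := by
    simp only [Finset.sum_apply]
    exact measurableSet_le measurable_const
      (((Finset.measurable_sum _ fun i _ => hmeas.comp (measurable_pi_apply i)).sub_const _).abs)
  rw [hset, measure_compl hms (measure_ne_top _ _), measure_univ]
  calc (1 / 2 : ENNReal) = 1 - 1 / 2 := by simp
    _ ≤ _ := tsub_le_tsub_left (hcheb.trans hhalf) 1

/-! ### Maximal deviations -/

theorem measureReal_empiricalMeasure {E : Type*} [MeasurableSpace E] {n : ℕ} (x : Fin n → E)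
    {A : Set E} (hA : MeasurableSet A) :
    (empiricalMeasure x).real A = (∑ i, A.indicator (1 : E → ℝ) (x i)) / n := by
  have h : ∀ i, (A.indicator (1 : E → ENNReal) (x i)).toReal = A.indicator (1 : E → ℝ) (x i) := by
    intro i
    by_cases hx : x i ∈ A <;> simp [hx]
  have hne : ∀ i ∈ Finset.univ, A.indicator (1 : E → ENNReal) (x i) ≠ ⊤ := by
    intro i _
    by_cases hx : x i ∈ A <;> simp [hx]
  simp only [Measure.real, empiricalMeasure, Measure.smul_apply, Measure.finsetSum_apply,
    Measure.dirac_apply' _ hA, smul_eq_mul, ENNReal.toReal_mul, ENNReal.toReal_inv,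
    ENNReal.toReal_natCast, ENNReal.toReal_sum hne, h]
  rw [mul_comm, div_eq_mul_inv]

/-- By dominated convergence both measures converge along the approximating sets, so a strict
inequality at `A` already holds at one of them. -/
theorem PointwiseMeasurable.exists_countable {E : Type*} [MeasurableSpace E] {𝒜 : Set (Set E)}
    (h : PointwiseMeasurable 𝒜) (hne : 𝒜.Nonempty) (hmeas : ∀ A ∈ 𝒜, MeasurableSet A) :
    ∃ 𝒜₀ ⊆ 𝒜, 𝒜₀.Countable ∧ ∀ (ν μ : Measure E) [IsFiniteMeasure ν] [IsFiniteMeasure μ] (t : ℝ),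
      t < maxDeviation 𝒜 ν μ → ∃ A ∈ 𝒜₀, t < |ν.real A - μ.real A| := by
  obtain ⟨𝒜₀, hsub, hcount, happrox⟩ := h
  refine ⟨𝒜₀, hsub, hcount, fun ν μ _ _ t ht => ?_⟩
  have : Nonempty 𝒜 := hne.to_subtype
  obtain ⟨⟨A, hA⟩, hlt⟩ := exists_lt_of_lt_ciSup ht
  obtain ⟨s, hs, hlim⟩ := happrox A hA
  have hev : ∀ x, ∀ᶠ k in atTop, x ∈ s k ↔ x ∈ A := fun x =>
    (tendsto_indicator_const_apply_iff_eventually atTop (1 : ℝ) x).1 (hlim x)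
  have key : ∀ (ρ : Measure E) [IsFiniteMeasure ρ],
      Tendsto (fun k => ρ.real (s k)) atTop (𝓝 (ρ.real A)) := fun ρ _ =>
    (ENNReal.tendsto_toReal (measure_ne_top ρ A)).comp
      (tendsto_measure_of_tendsto_indicator_of_isFiniteMeasure atTop ρ
        (fun k => hmeas _ (hsub (hs k))) hev)
  obtain ⟨k, hk⟩ := (((key ν).sub (key μ)).abs.eventually (lt_mem_nhds hlt)).exists
  exact ⟨s k, hs k, hk⟩

theorem measurableSet_exists_lt_abs {Z ι : Type*} [MeasurableSpace Z] {S : Set ι}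
    (hS : S.Countable) {f : ι → Z → ℝ} (hf : ∀ i ∈ S, Measurable (f i)) (u : ℝ) :
    MeasurableSet {z | ∃ i ∈ S, u < |f i z|} := by
  have : {z | ∃ i ∈ S, u < |f i z|} = ⋃ i ∈ S, {z | u < |f i z|} := by
    ext z
    simp
  rw [this]
  exact .biUnion hS fun i hi => measurableSet_lt measurable_const (hf i hi).abs

theorem measure_exists_lt_abs_sum_indicator_sub_le {E : Type*} [MeasurableSpace E] [Nonempty E]
    (μ : Measure E) [IsProbabilityMeasure μ] {n : ℕ} {𝒜 : Set (Set E)} (hcount : 𝒜.Countable)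
    (hmeas : ∀ A ∈ 𝒜, MeasurableSet A) {R : Set E} (hR : MeasurableSet R)
    (h𝒜R : ∀ A ∈ 𝒜, A ⊆ R) (hnR : 0 < n * μ.real R) {s u : ℝ} (hs : 0 < s) (hu : 0 ≤ u)
    (hsR : 2 * n * μ.real R ≤ s ^ 2) :
    (Measure.pi fun _ : Fin n => μ)
        {x | ∃ A ∈ 𝒜, s + u < |∑ i, A.indicator (1 : E → ℝ) (x i) - n * μ.real A|} ≤
      2 * (ENNReal.ofReal (shatteringCoeffReal 𝒜 (4 * n * μ.real R) *
        (2 * Real.exp (-(u ^ 2 / (2 * (4 * n * μ.real R)))))) +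
        ENNReal.ofReal (Real.exp (-(n * μ.real R / 2)))) := by
  have hsum : ∀ A ∈ 𝒜, Measurable fun x : Fin n → E => ∑ i, A.indicator (1 : E → ℝ) (x i) :=
    fun A hA => Finset.measurable_sum _ fun i _ =>
      (measurable_indicator_one (hmeas A hA)).comp (measurable_pi_apply i)
  have hB := measurableSet_exists_lt_abs hcount
    (fun A hA => (hsum A hA).sub_const (n * μ.real A)) (s + u)
  have hC := measurableSet_exists_lt_abs hcount
    (f := fun A (z : (Fin n → E) × (Fin n → E)) =>
      ∑ i, A.indicator (1 : E → ℝ) (z.1 i) - ∑ i, A.indicator (1 : E → ℝ) (z.2 i))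
    (fun A hA => ((hsum A hA).comp measurable_fst).sub ((hsum A hA).comp measurable_snd)) u
  have hC' := measurableSet_exists_lt_abs hcount
    (f := fun A (z : Fin n → E × E) => ∑ i, pairDiff A (z i))
    (fun A hA => Finset.measurable_sum _ fun i _ =>
      (measurable_pairDiff (hmeas A hA)).comp (measurable_pi_apply i)) u
  have hG : MeasurableSet {z : Fin n → E × E | 4 * n * μ.real R < ∑ i, pairCount R (z i)} :=
    measurableSet_lt measurable_const (Finset.measurable_sum _ fun i _ =>
      (measurable_pairCount hR).comp (measurable_pi_apply i))
  refine (measure_le_two_mul_prod _ (Measure.pi fun _ : Fin n => μ) hB hC ?_).trans ?_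
  · rintro x ⟨A, hA, hx⟩
    have hAR : μ.real A ≤ μ.real R := measureReal_mono (h𝒜R A hA)
    refine (half_le_measure_abs_sum_indicator_sub_lt μ (hmeas A hA) hs
      (le_trans (by gcongr) hsR)).trans (measure_mono fun y hy => ⟨A, hA, ?_⟩)
    have h1 := abs_sub_le (∑ i, A.indicator (1 : E → ℝ) (x i))
      (∑ i, A.indicator (1 : E → ℝ) (y i)) (n * μ.real A)
    have h2 : |∑ i, A.indicator (1 : E → ℝ) (y i) - n * μ.real A| < s := hy
    change u < |∑ i, A.indicator (1 : E → ℝ) (x i) - ∑ i, A.indicator (1 : E → ℝ) (y i)|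
    linarith
  gcongr
  -- A pair of samples is read as a sample of pairs, so that each pair can be swapped separately.
  rw [← (measurePreserving_arrowProdEquivProdArrow E E (Fin n) (fun _ => μ)
    fun _ => μ).measure_preimage hC.nullMeasurableSet]
  have hpre : MeasurableEquiv.arrowProdEquivProdArrow E E (Fin n) ⁻¹'
      {z | ∃ A ∈ 𝒜, u < |∑ i, A.indicator (1 : E → ℝ) (z.1 i) -
        ∑ i, A.indicator (1 : E → ℝ) (z.2 i)|} =
      {z | ∃ A ∈ 𝒜, u < |∑ i, pairDiff A (z i)|} := by
    ext z
    simp only [Set.mem_preimage, Set.mem_ofPred_eq, pairDiff, Finset.sum_sub_distrib]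
    rfl
  rw [hpre]
  refine (measure_le_of_card_le (Measure.pi fun _ : Fin n => μ.prod μ)
    (fun (ε : Fin n → Bool) z i => swapIf (ε i) (z i))
    (fun ε => measurePreserving_pi _ _ fun i => measurePreserving_swapIf μ (ε i)) hC' hG
    (q := shatteringCoeffReal 𝒜 (4 * n * μ.real R) *
        (2 * Real.exp (-(u ^ 2 / (2 * (4 * n * μ.real R)))))) fun z hz => ?_).trans ?_
  · have := card_exists_lt_abs_sum_sign_le h𝒜R (V := 4 * n * μ.real R) (by linarith) hu z
      (not_lt.1 hz)
    simpa [pairDiff_swapIf] using this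
  · gcongr
    rw [← ofReal_measureReal]
    exact ENNReal.ofReal_le_ofReal (measureReal_lt_sum_pairCount_le μ hR n)

theorem shatteringCoeff_mono_class {E : Type*} {𝒜 ℬ : Set (Set E)} (h : 𝒜 ⊆ ℬ) (n : ℕ) :
    shatteringCoeff 𝒜 n ≤ shatteringCoeff ℬ n := by
  refine ciSup_mono (bddAbove_ncard_traces ℬ n) fun x => ?_
  refine Set.ncard_le_ncard ?_ (finite_traces ℬ x)
  rintro B ⟨A, hA, rfl⟩
  exact ⟨A, h hA, rfl⟩

end RareVC

open RareVC

theorem mainTheorem2 {d n : ℕ} {Ω : Type*} [MeasurableSpace Ω]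
    (P : MeasureTheory.Measure Ω) [MeasureTheory.IsProbabilityMeasure P]
    (μ : MeasureTheory.Measure (EuclideanSpace ℝ (Fin d))) [MeasureTheory.IsProbabilityMeasure μ]
    (X : Fin n → Ω → EuclideanSpace ℝ (Fin d))
    (hXm : ∀ i, Measurable (X i))
    (hXlaw : ∀ i, P.map (X i) = μ)
    (hXindep : ProbabilityTheory.iIndepFun X P)
    (𝒜 : Set (Set (EuclideanSpace ℝ (Fin d))))
    (h𝒜ne : 𝒜.Nonempty)
    (h𝒜meas : ∀ A ∈ 𝒜, MeasurableSet A)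
    (h𝒜pm : RareVC.PointwiseMeasurable 𝒜)
    (R : Set (EuclideanSpace ℝ (Fin d))) (hR : MeasurableSet R)
    (h𝒜R : ∀ A ∈ 𝒜, A ⊆ R)
    (p : ℝ) (hp : p = μ.real R)
    (δ : ℝ) (hδ : δ ∈ Set.Ioo (0 : ℝ) 1)
    (hnp : 2 * Real.log (8 / δ) ≤ (n : ℝ) * p) :
    1 - δ ≤ P.real {ω | RareVC.maxDeviation 𝒜 (RareVC.empiricalMeasure fun i => X i ω) μ ≤
      Real.sqrt (2 * p / n) *
        (2 * Real.sqrt (Real.log (8 / δ) +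
          Real.log (RareVC.shatteringCoeffReal 𝒜 (8 * n * p))) + 1)} := by
  classical
  obtain ⟨hδ0, hδ1⟩ := hδ
  have hlog : 0 < Real.log (8 / δ) := Real.log_pos (by rw [lt_div_iff₀ hδ0]; linarith)
  have hnp0 : 0 < (n : ℝ) * p := by linarith
  have hn0 : (0 : ℝ) < n := by
    rcases (Nat.cast_nonneg (α := ℝ) n).eq_or_lt with h | h
    · simp [← h] at hnp0
    · exact h
  have hp0 : 0 < p := pos_of_mul_pos_right hnp0 hn0.le
  set S := shatteringCoeffReal 𝒜 (8 * n * p) with hSdef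
  have hS1 : (1 : ℝ) ≤ S := Nat.one_le_cast.2 (one_le_shatteringCoeff h𝒜ne _)
  have hlogS : 0 ≤ Real.log S := Real.log_nonneg hS1
  set l := Real.log (8 / δ) + Real.log S with hl
  set t := Real.sqrt (2 * p / n) * (2 * Real.sqrt l + 1) with ht
  set s := Real.sqrt (2 * (n * p)) with hs
  set u := s * (2 * Real.sqrt l) with hu
  have hs0 : 0 < s := Real.sqrt_pos.2 (by linarith)
  have hs2 : s ^ 2 = 2 * (n * p) := Real.sq_sqrt (by linarith)
  have hu2 : u ^ 2 = 8 * (n * p) * l := by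
    rw [hu, mul_pow, mul_pow, hs2, Real.sq_sqrt (by linarith)]
    ring
  have hsqrt : n * Real.sqrt (2 * p / n) = s := by
    rw [hs, ← Real.sqrt_sq hn0.le, ← Real.sqrt_mul (by positivity), Real.sqrt_sq hn0.le]
    congr 1
    field_simp
  have hnt : n * t = s + u := by
    rw [ht, ← mul_assoc, hsqrt, hu]
    ring
  obtain ⟨𝒜₀, hsub, hcount, hdev⟩ := h𝒜pm.exists_countable h𝒜ne h𝒜meas
  have hmeas₀ : ∀ A ∈ 𝒜₀, MeasurableSet A := fun A hA => h𝒜meas A (hsub hA)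
  have hmain := measure_exists_lt_abs_sum_indicator_sub_le μ (n := n) hcount hmeas₀ hR
    (fun A hA => h𝒜R A (hsub hA)) (by rw [← hp]; exact hnp0) hs0 (u := u) (by positivity)
    (by rw [← hp, hs2]; linarith)
  rw [← hp] at hmain
  set B := {x : Fin n → EuclideanSpace ℝ (Fin d) |
    ∃ A ∈ 𝒜₀, s + u < |∑ i, A.indicator (1 : EuclideanSpace ℝ (Fin d) → ℝ) (x i) -
      n * μ.real A|} with hB
  -- The argument only needs `S(4np)`; the stated `8np` enters by monotonicity.
  have hS₀ : (shatteringCoeffReal 𝒜₀ (4 * n * p) : ℝ) ≤ S := by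
    refine Nat.cast_le.2 ((shatteringCoeff_mono_class hsub _).trans
      (shatteringCoeff_mono 𝒜 (Nat.floor_mono ?_)))
    linarith
  have hexp1 : Real.exp (-(u ^ 2 / (2 * (4 * n * p)))) = δ / 8 / S := by
    have : u ^ 2 / (2 * (4 * n * p)) = l := by
      rw [hu2]
      field_simp
      ring
    rw [this, hl, neg_add, Real.exp_add, ← Real.log_inv, ← Real.log_inv,
      Real.exp_log (by positivity), Real.exp_log (by positivity), inv_div, div_eq_mul_inv _ (S : ℝ)]
  have hexp2 : Real.exp (-(n * p / 2)) ≤ δ / 8 := by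
    calc Real.exp (-(n * p / 2)) ≤ Real.exp (-Real.log (8 / δ)) := by gcongr; linarith
      _ = δ / 8 := by rw [← Real.log_inv, Real.exp_log (by positivity), inv_div]
  -- The two terms contribute `2 * (δ/4)` and at most `2 * (δ/8)`.
  have hQ : (MeasureTheory.Measure.pi fun _ : Fin n => μ) B ≤ ENNReal.ofReal δ := by
    refine hmain.trans ?_
    rw [hexp1, ← ENNReal.ofReal_add (by positivity) (Real.exp_pos _).le,
      ← ENNReal.ofReal_ofNat, ← ENNReal.ofReal_mul (by norm_num)]
    refine ENNReal.ofReal_le_ofReal ?_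
    have : (shatteringCoeffReal 𝒜₀ (4 * n * p) : ℝ) * (2 * (δ / 8 / S)) ≤ δ / 4 :=
      calc _ ≤ (S : ℝ) * (2 * (δ / 8 / S)) := by gcongr
        _ = δ / 4 := by field_simp; ring
    linarith
  have hBm : MeasurableSet B := measurableSet_exists_lt_abs hcount
    (fun A hA => (Finset.measurable_sum _ fun i _ =>
      (measurable_indicator_one (hmeas₀ A hA)).comp (measurable_pi_apply i)).sub_const _) _
  have hlaw : P.map (fun ω i => X i ω) = MeasureTheory.Measure.pi fun _ => μ := by
    rw [(ProbabilityTheory.iIndepFun_iff_map_fun_eq_pi_map fun i => (hXm i).aemeasurable).1 hXindep]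
    simp only [hXlaw]
  rw [← hlaw, MeasureTheory.Measure.map_apply (measurable_pi_lambda _ hXm) hBm] at hQ
  set good := {ω | maxDeviation 𝒜 (empiricalMeasure fun i => X i ω) μ ≤ t} with hgood
  -- A cover and subadditivity avoid any need for `good` to be measurable.
  have hcover : Set.univ ⊆ good ∪ (fun ω i => X i ω) ⁻¹' B := by
    intro ω _
    by_cases hω : ω ∈ good
    · exact Or.inl hω
    right
    have := isProbabilityMeasure_empiricalMeasure (Nat.cast_pos.1 hn0).ne' fun i => X i ω
    obtain ⟨A, hA, hlt⟩ := hdev (empiricalMeasure fun i => X i ω) μ t (not_le.1 hω)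
    refine ⟨A, hA, ?_⟩
    rw [measureReal_empiricalMeasure _ (hmeas₀ A hA)] at hlt
    calc s + u = n * t := hnt.symm
      _ < n * |(∑ i, A.indicator (1 : EuclideanSpace ℝ (Fin d) → ℝ) (X i ω)) / n - μ.real A| := by
          gcongr
      _ = _ := by
          rw [← abs_of_pos hn0, ← abs_mul, abs_of_pos hn0, mul_sub, mul_div_cancel₀ _ hn0.ne']
  have h1 : (1 : ENNReal) ≤ P good + ENNReal.ofReal δ := by
    rw [← MeasureTheory.measure_univ (μ := P)]
    exact (MeasureTheory.measure_mono hcover).trans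
      ((MeasureTheory.measure_union_le _ _).trans (by gcongr))
  rw [← MeasureTheory.ofReal_measureReal (μ := P) (s := good), ← ENNReal.ofReal_add
    MeasureTheory.measureReal_nonneg hδ0.le, ENNReal.one_le_ofReal] at h1
  linarith
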